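/- Let $K$ be a field, let $R=K[x_1,\dots,x_n]$ with the standard grading, and let $I\subseteq R$ be a monomial ideal of height $h$. Consider the following condition on a monomial ideal $I$ of height $h$: $(\ast)$ $I$ has a primary decomposition $I=Q_1\cap\cdots\cap Q_r\cap Q_{r+1}\cap\cdots\cap Q_t$ which is reduced (the radicals $\sqrt{Q_i}$ are pairwise distinct) and irredundant ($Q_i\not\supseteq\bigcap_{j\ne i}Q_j$ for every $i$), such that $\operatorname{height}(Q_i)=h$ for $1\le i\le r$, $\operatorname{height}(Q_i)>h$ for $r<i\le t$, and each $Q_i$ with $1\le i\le r$ is an irreducible monomial ideal generated by pure powers $x_{j_1}^{a_{i_1}},\dots,x_{j_h}^{a_{i_h}}$ (with positive exponents) of $h$ distinct variables. For $m\ge 1$ let the $m$-th special power $I^{\{m\}}$ be the ideal generated by the $m$-th powers of the minimal monomial generators of $I$. For a graded ideal $J\subsetneq R$, the multiplicity $\operatorname{mult}(R/J)$ is defined as follows: if $\dim R/J=d+1\ge 1$ and the Hilbert polynomial of $R/J$ is written as $\sum_{i=0}^{d}(-1)^i e_i\binom{t+d-i}{d-i}$, then $\operatorname{mult}(R/J)=e_0$;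 if $\dim R/J=0$, then $\operatorname{mult}(R/J)=\dim_K R/J$. **Theorem.** If $I$ satisfies $(\ast)$, then for every integer $m\ge1$ the ideal $I^{\{m\}}$ is a monomial ideal of height $h$ that also satisfies $(\ast)$. Moreover, for all integers $m,s\ge 1$, $$\operatorname{mult}\bigl(R/(I^{\{m\}})^s\bigr)=m^h\binom{h+s-1}{s-1}\operatorname{mult}(R/I).$$ -/

import Mathlib

open Filter

section MonomialIdeals

variable {K : Type*} [Field K] {n : ℕ}

/-- An ideal of `K[x₁, …, xₙ]` is a monomial ideal if it is generated by a set of monomials. -/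
def IsMonomialIdeal (I : Ideal (MvPolynomial (Fin n) K)) : Prop :=
  ∃ S : Set (Fin n →₀ ℕ), I = Ideal.span ((fun a => MvPolynomial.monomial a (1 : K)) '' S)

/-- The exponent vectors of the minimal monomial generators of `I`: the monomials that belong to
`I` and are minimal, with respect to divisibility, among the monomials belonging to `I`. -/
def minimalGeneratorExponents (I : Ideal (MvPolynomial (Fin n) K)) : Set (Fin n →₀ ℕ) :=
  {a | Minimal (fun b : Fin n →₀ ℕ => MvPolynomial.monomial b (1 : K) ∈ I) a}

/-- The `m`-th special power `I^{m}` of a monomial ideal `I`: the ideal generated by the `m`-th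
powers of the minimal monomial generators of `I`. -/
noncomputable def specialPower (I : Ideal (MvPolynomial (Fin n) K)) (m : ℕ) :
    Ideal (MvPolynomial (Fin n) K) :=
  Ideal.span ((fun a => MvPolynomial.monomial a (1 : K) ^ m) '' minimalGeneratorExponents I)

/-- A proper monomial ideal is irreducible if it is not the intersection of two monomial ideals
both different from it. -/
def IsIrreducibleMonomialIdeal (Q : Ideal (MvPolynomial (Fin n) K)) : Prop :=
  IsMonomialIdeal Q ∧ Q ≠ ⊤ ∧
    ∀ J₁ J₂ : Ideal (MvPolynomial (Fin n) K), IsMonomialIdeal J₁ → IsMonomialIdeal J₂ →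
      Q = J₁ ⊓ J₂ → Q = J₁ ∨ Q = J₂

/-- `Q` is generated by pure powers, with positive exponents, of `h` distinct variables. -/
def IsGeneratedByPurePowers (Q : Ideal (MvPolynomial (Fin n) K)) (h : ℕ) : Prop :=
  ∃ (v : Finset (Fin n)) (a : Fin n → ℕ), v.card = h ∧ (∀ j ∈ v, 0 < a j) ∧
    Q = Ideal.span ((fun j => (MvPolynomial.X j : MvPolynomial (Fin n) K) ^ a j) '' (v : Set (Fin n)))

/-- `I` is a monomial ideal of height `h` having a primary decomposition, irredundant and with
pairwise distinct radicals, all of whose components have height at least `h`, and whose components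
of height exactly `h` are irreducible monomial ideals generated by pure powers of `h` variables.
The components of height greater than `h` are arbitrary primary ideals. -/
structure HasIrreducibleTopComponents (I : Ideal (MvPolynomial (Fin n) K)) (h : ℕ) : Prop where
  isMonomialIdeal : IsMonomialIdeal I
  height_eq : I.height = (h : ℕ∞)
  exists_decomposition : ∃ t : Finset (Ideal (MvPolynomial (Fin n) K)),
    Submodule.IsMinimalPrimaryDecomposition I t ∧
    (∀ Q ∈ t, (h : ℕ∞) ≤ Q.height) ∧
    (∀ Q ∈ t, Q.height = (h : ℕ∞) → IsIrreducibleMonomialIdeal Q ∧ IsGeneratedByPurePowers Q h)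

end MonomialIdeals

section Multiplicity

variable {K : Type*} [Field K] {n : ℕ}

/-- The Hilbert function of `R/J`, where `R = K[x₁, …, xₙ]` has the standard grading and `J` is a
graded ideal: the `K`-dimension of the image of the forms of degree `k` in `R/J`. -/
noncomputable def hilbertFunction (J : Ideal (MvPolynomial (Fin n) K)) (k : ℕ) : ℕ :=
  Module.finrank K
    ((MvPolynomial.homogeneousSubmodule (Fin n) K k).map (Ideal.Quotient.mkₐ K J).toLinearMap)

/-- `HasMultiplicity J e`: the multiplicity of the graded `R`-module `R/J` is `e`.
If `dim R/J = d + 1`, this says that `e = e₀` where the Hilbert polynomial of `R/J` is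
`∑_{i=0}^{d} (-1)^i eᵢ (t+d-i choose d-i)`; if `dim R/J = 0`, it says that `e` is the length of
`R/J`, that is, its dimension over `K`. -/
def HasMultiplicity (J : Ideal (MvPolynomial (Fin n) K)) (e : ℤ) : Prop :=
  (ringKrullDim (MvPolynomial (Fin n) K ⧸ J) = 0 ∧
    Module.Finite K (MvPolynomial (Fin n) K ⧸ J) ∧
    (Module.finrank K (MvPolynomial (Fin n) K ⧸ J) : ℤ) = e) ∨
  ∃ d : ℕ, ringKrullDim (MvPolynomial (Fin n) K ⧸ J) = ((d + 1 : ℕ) : WithBot ℕ∞) ∧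
    ∃ c : ℕ → ℤ, c 0 = e ∧
      ∀ᶠ k : ℕ in atTop, (hilbertFunction J k : ℤ) =
        ∑ i ∈ Finset.range (d + 1), (-1) ^ i * c i * ((k + (d - i)).choose (d - i) : ℤ)

/-- The leading Hilbert coefficient is determined by the values of the polynomial at large
integers. -/
theorem hilbertCoefficient_zero_unique (d : ℕ) (b c : ℕ → ℤ)
    (hbc : ∀ᶠ k : ℕ in atTop,
      ∑ i ∈ Finset.range (d + 1), (-1) ^ i * b i * ((k + (d - i)).choose (d - i) : ℤ) =
        ∑ i ∈ Finset.range (d + 1), (-1) ^ i * c i * ((k + (d - i)).choose (d - i) : ℤ)) :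
    b 0 = c 0 := by
  induction d with
  | zero => obtain ⟨k, hk⟩ := hbc.exists; simpa using hk
  | succ d ih =>
    have key : ∀ (a : ℕ → ℤ) (k : ℕ),
        ∑ i ∈ Finset.range (d + 1), (-1) ^ i * a i * ((k + 1 + (d - i)).choose (d - i) : ℤ) =
        ∑ i ∈ Finset.range (d + 1 + 1),
          (-1) ^ i * a i * ((k + 1 + (d + 1 - i)).choose (d + 1 - i) : ℤ) -
        ∑ i ∈ Finset.range (d + 1 + 1),
          (-1) ^ i * a i * ((k + (d + 1 - i)).choose (d + 1 - i) : ℤ) := by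
      intro a k
      rw [Finset.sum_range_succ _ (d + 1), Finset.sum_range_succ _ (d + 1)]
      simp only [Nat.sub_self, Nat.choose_zero_right, add_sub_add_right_eq_sub,
        ← Finset.sum_sub_distrib]
      refine Finset.sum_congr rfl fun i hi => ?_
      have hi' : d + 1 - i = (d - i) + 1 := by
        have := Finset.mem_range.1 hi
        omega
      rw [hi', ← mul_sub, show k + 1 + (d - i + 1) = (k + 1 + (d - i)) + 1 by ring,
        Nat.choose_succ_succ, show k + (d - i + 1) = k + 1 + (d - i) by ring]
      push_cast
      ring
    apply ih
    obtain ⟨N, hN⟩ := eventually_atTop.1 hbc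
    refine eventually_atTop.2 ⟨N + 1, fun k hk => ?_⟩
    obtain ⟨j, rfl⟩ : ∃ j, k = j + 1 := ⟨k - 1, by omega⟩
    rw [key, key, hN j (by omega), hN (j + 1) (by omega)]

/-- The multiplicity is unique. -/
theorem HasMultiplicity.unique {J : Ideal (MvPolynomial (Fin n) K)} {e e' : ℤ}
    (he : HasMultiplicity J e) (he' : HasMultiplicity J e') : e = e' := by
  rcases he with ⟨h0, -, h1⟩ | ⟨d, hd, c, rfl, hc⟩ <;>
    rcases he' with ⟨h0', -, h1'⟩ | ⟨d', hd', c', rfl, hc'⟩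
  · exact h1.symm.trans h1'
  · rw [h0] at hd'
    exact absurd (by exact_mod_cast hd' : (0 : ℕ) = d' + 1) (by omega)
  · rw [h0'] at hd
    exact absurd (by exact_mod_cast hd : (0 : ℕ) = d + 1) (by omega)
  · obtain rfl : d = d' := by
      have : d + 1 = d' + 1 := by exact_mod_cast hd.symm.trans hd'
      omega
    apply hilbertCoefficient_zero_unique d
    filter_upwards [hc, hc'] with k h1 h2
    rw [← h1, h2]

end Multiplicity

/-! A minimal prime of height h over a monomial ideal is generated by a set `v` of h variables, and
its primary component is isolated, hence the same in every minimal decomposition. So (∗) is a local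
condition: for each such `v`, inverting the variables outside `v` turns `I` into an ideal generated
by pure powers x_j^{a_j}, j ∈ v (`exists_localExponents_iff` and its converse
`hasIrreducibleTopComponents`). The special power lies in the same primes as `I` and replaces a_j by
m·a_j, so it inherits (∗).

By the associativity formula (`IsMonomialIdeal.hasMultiplicity`) the multiplicity is the sum, over
the `v` of size h, of the number of monomials in the variables of `v` outside the localized ideal.
With b_j = m·a_j, a monomial x^d lies in the s-th power of (x_j^{b_j}) iff Σ⌊d_j/b_j⌋ ≥ s. Division
with remainder counts the others: ∏ b_j times the number of monomials of degree < s in h variables,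
that is m^h ∏ a_j · binom(h+s-1, s-1). For `I` itself the count is ∏ a_j, so every local term is
scaled by the same factor.

The associativity formula is proved by counting. Truncating exponents at a large `N` sorts the
degree-k monomials outside `I` into finitely many classes, each counted by a polynomial for large k;
the classes of top degree correspond to the local monomials. -/

/-! ### Monomial ideals through their exponent sets -/

section Exponents

variable {K : Type*} [Field K] {n : ℕ}

/-- The exponent vectors of the monomials belonging to an ideal. -/
def monomialExponents (I : Ideal (MvPolynomial (Fin n) K)) : Set (Fin n →₀ ℕ) :=
  {d | MvPolynomial.monomial d (1 : K) ∈ I}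

theorem mem_monomialExponents {I : Ideal (MvPolynomial (Fin n) K)} {d : Fin n →₀ ℕ} :
    d ∈ monomialExponents I ↔ MvPolynomial.monomial d (1 : K) ∈ I := Iff.rfl

theorem add_mem_monomialExponents_mul {I J : Ideal (MvPolynomial (Fin n) K)} {a b : Fin n →₀ ℕ}
    (ha : a ∈ monomialExponents I) (hb : b ∈ monomialExponents J) :
    a + b ∈ monomialExponents (I * J) := by
  have := Ideal.mul_mem_mul (mem_monomialExponents.1 ha) (mem_monomialExponents.1 hb)
  rwa [MvPolynomial.monomial_mul, one_mul] at this

theorem isUpperSet_monomialExponents (I : Ideal (MvPolynomial (Fin n) K)) :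
    IsUpperSet (monomialExponents I) := by
  intro a b hab ha
  obtain ⟨c, rfl⟩ := exists_add_of_le hab
  have := I.mul_mem_right (MvPolynomial.monomial c (1 : K)) (mem_monomialExponents.1 ha)
  rwa [MvPolynomial.monomial_mul, one_mul] at this

theorem mem_monomialExponents_span {S : Set (Fin n →₀ ℕ)} {d : Fin n →₀ ℕ} :
    d ∈ monomialExponents (Ideal.span ((fun a => MvPolynomial.monomial a (1 : K)) '' S)) ↔
      ∃ a ∈ S, a ≤ d := by
  classical
  rw [mem_monomialExponents, MvPolynomial.mem_ideal_span_monomial_image]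
  simp [MvPolynomial.support_monomial]

theorem IsMonomialIdeal.mem_iff {I : Ideal (MvPolynomial (Fin n) K)} (hI : IsMonomialIdeal I)
    {f : MvPolynomial (Fin n) K} : f ∈ I ↔ ∀ d ∈ f.support, d ∈ monomialExponents I := by
  obtain ⟨S, rfl⟩ := hI
  simp_rw [mem_monomialExponents_span, MvPolynomial.mem_ideal_span_monomial_image]

theorem IsMonomialIdeal.le_iff {I J : Ideal (MvPolynomial (Fin n) K)} (hI : IsMonomialIdeal I) :
    I ≤ J ↔ monomialExponents I ⊆ monomialExponents J := by
  refine ⟨fun h d hd => h hd, fun h => ?_⟩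
  obtain ⟨S, rfl⟩ := hI
  rw [Ideal.span_le]
  rintro _ ⟨a, ha, rfl⟩
  exact h (mem_monomialExponents_span.2 ⟨a, ha, le_rfl⟩)

open Pointwise in
theorem span_monomial_mul_span_monomial (S T : Set (Fin n →₀ ℕ)) :
    Ideal.span ((fun a => MvPolynomial.monomial a (1 : K)) '' S) *
      Ideal.span ((fun a => MvPolynomial.monomial a (1 : K)) '' T) =
    Ideal.span ((fun a => MvPolynomial.monomial a (1 : K)) '' Set.image2 (· + ·) S T) := by
  rw [Ideal.span_mul_span']
  congr 1
  ext f
  simp only [Set.mem_mul, Set.mem_image, Set.mem_image2]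
  constructor
  · rintro ⟨_, ⟨a, ha, rfl⟩, _, ⟨b, hb, rfl⟩, rfl⟩
    exact ⟨a + b, ⟨a, ha, b, hb, rfl⟩, by simp [MvPolynomial.monomial_mul]⟩
  · rintro ⟨_, ⟨a, ha, b, hb, rfl⟩, rfl⟩
    exact ⟨_, ⟨a, ha, rfl⟩, _, ⟨b, hb, rfl⟩, by simp [MvPolynomial.monomial_mul]⟩

theorem IsMonomialIdeal.mul {I J : Ideal (MvPolynomial (Fin n) K)} (hI : IsMonomialIdeal I)
    (hJ : IsMonomialIdeal J) : IsMonomialIdeal (I * J) := by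
  obtain ⟨S, rfl⟩ := hI
  obtain ⟨T, rfl⟩ := hJ
  exact ⟨_, span_monomial_mul_span_monomial S T⟩

theorem isMonomialIdeal_top : IsMonomialIdeal (⊤ : Ideal (MvPolynomial (Fin n) K)) := by
  refine ⟨{0}, ?_⟩
  rw [Set.image_singleton, eq_comm, Ideal.eq_top_iff_one]
  exact Ideal.subset_span rfl

theorem IsMonomialIdeal.pow {I : Ideal (MvPolynomial (Fin n) K)} (hI : IsMonomialIdeal I) (s : ℕ) :
    IsMonomialIdeal (I ^ s) := by
  induction s with
  | zero => rw [pow_zero, Ideal.one_eq_top]; exact isMonomialIdeal_top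
  | succ s ih => rw [pow_succ]; exact ih.mul hI

theorem IsMonomialIdeal.mem_monomialExponents_mul {I J : Ideal (MvPolynomial (Fin n) K)}
    (hI : IsMonomialIdeal I) (hJ : IsMonomialIdeal J) {d : Fin n →₀ ℕ} :
    d ∈ monomialExponents (I * J) ↔
      ∃ a ∈ monomialExponents I, ∃ b ∈ monomialExponents J, d = a + b := by
  constructor
  · intro hd
    obtain ⟨S, rfl⟩ := hI
    obtain ⟨T, rfl⟩ := hJ
    rw [span_monomial_mul_span_monomial, mem_monomialExponents_span] at hd
    obtain ⟨_, ⟨a, ha, b, hb, rfl⟩, hle⟩ := hd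
    obtain ⟨c, rfl⟩ := exists_add_of_le hle
    exact ⟨a, mem_monomialExponents_span.2 ⟨a, ha, le_rfl⟩, b + c,
      mem_monomialExponents_span.2 ⟨b, hb, le_self_add⟩, add_assoc _ _ _⟩
  · rintro ⟨a, ha, b, hb, rfl⟩
    exact add_mem_monomialExponents_mul ha hb

theorem exists_minimalGeneratorExponents_le {I : Ideal (MvPolynomial (Fin n) K)} {d : Fin n →₀ ℕ}
    (hd : d ∈ monomialExponents I) : ∃ a ∈ minimalGeneratorExponents I, a ≤ d := by
  obtain ⟨a, had, ha⟩ := exists_minimal_le_of_wellFoundedLT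
    (fun b : Fin n →₀ ℕ => MvPolynomial.monomial b (1 : K) ∈ I) d hd
  exact ⟨a, ha, had⟩

theorem specialPower_eq_span (I : Ideal (MvPolynomial (Fin n) K)) (m : ℕ) :
    specialPower I m = Ideal.span ((fun a => MvPolynomial.monomial a (1 : K)) ''
      ((fun a => m • a) '' minimalGeneratorExponents I)) := by
  rw [specialPower, Set.image_image]
  simp [MvPolynomial.monomial_pow]

theorem isMonomialIdeal_specialPower (I : Ideal (MvPolynomial (Fin n) K)) (m : ℕ) :
    IsMonomialIdeal (specialPower I m) := ⟨_, specialPower_eq_span I m⟩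

/-- Multiplication by `m` is monotone, so minimal generators may be replaced by arbitrary monomials
of `I`. -/
theorem mem_monomialExponents_specialPower {I : Ideal (MvPolynomial (Fin n) K)} {m : ℕ}
    {d : Fin n →₀ ℕ} :
    d ∈ monomialExponents (specialPower I m) ↔ ∃ a ∈ monomialExponents I, m • a ≤ d := by
  rw [specialPower_eq_span, mem_monomialExponents_span, Set.exists_mem_image]
  constructor
  · rintro ⟨a, ha, h⟩
    exact ⟨a, Minimal.prop ha, h⟩
  · rintro ⟨a, ha, h⟩
    obtain ⟨b, hb, hba⟩ := exists_minimalGeneratorExponents_le ha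
    exact ⟨b, hb, (nsmul_le_nsmul_right hba m).trans h⟩

theorem specialPower_le {I : Ideal (MvPolynomial (Fin n) K)} {m : ℕ} (hm : 1 ≤ m) :
    specialPower I m ≤ I := by
  rw [(isMonomialIdeal_specialPower I m).le_iff]
  intro d hd
  obtain ⟨a, ha, had⟩ := mem_monomialExponents_specialPower.1 hd
  refine isUpperSet_monomialExponents I (le_trans ?_ had) ha
  intro j
  simpa using Nat.le_mul_of_pos_left (a j) hm

theorem IsMonomialIdeal.le_of_specialPower_le {I P : Ideal (MvPolynomial (Fin n) K)}
    (hI : IsMonomialIdeal I) [P.IsPrime] {m : ℕ} (h : specialPower I m ≤ P) : I ≤ P := by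
  rw [hI.le_iff]
  intro d hd
  have : m • d ∈ monomialExponents (specialPower I m) :=
    mem_monomialExponents_specialPower.2 ⟨d, hd, le_rfl⟩
  have := h this
  rw [← one_pow m, ← MvPolynomial.monomial_pow] at this
  exact Ideal.IsPrime.mem_of_pow_mem ‹_› _ this

end Exponents

/-! ### Ideals generated by pure powers of variables -/

section PurePowers

variable {K : Type*} [Field K] {n : ℕ}

variable (K) in
/-- The ideal generated by the powers `x_j ^ a_j`, `j ∈ v`. -/
noncomputable def purePowerIdeal (v : Finset (Fin n)) (a : Fin n → ℕ) :
    Ideal (MvPolynomial (Fin n) K) :=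
  Ideal.span ((fun j => (MvPolynomial.X j : MvPolynomial (Fin n) K) ^ a j) '' (v : Set (Fin n)))

theorem purePowerIdeal_eq_span (v : Finset (Fin n)) (a : Fin n → ℕ) :
    purePowerIdeal K v a = Ideal.span ((fun a => MvPolynomial.monomial a (1 : K)) ''
      ((fun j => Finsupp.single j (a j)) '' (v : Set (Fin n)))) := by
  rw [purePowerIdeal, Set.image_image]
  simp [MvPolynomial.X_pow_eq_monomial]

theorem isMonomialIdeal_purePowerIdeal (v : Finset (Fin n)) (a : Fin n → ℕ) :
    IsMonomialIdeal (purePowerIdeal K v a) := ⟨_, purePowerIdeal_eq_span v a⟩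

theorem mem_monomialExponents_purePowerIdeal {v : Finset (Fin n)} {a : Fin n → ℕ}
    {d : Fin n →₀ ℕ} :
    d ∈ monomialExponents (purePowerIdeal K v a) ↔ ∃ j ∈ v, a j ≤ d j := by
  rw [purePowerIdeal_eq_span, mem_monomialExponents_span]
  simp

variable (K) in
/-- The ideal generated by the variables `x_j`, `j ∈ v`. -/
noncomputable abbrev varIdeal (v : Finset (Fin n)) : Ideal (MvPolynomial (Fin n) K) :=
  purePowerIdeal K v 1

theorem varIdeal_eq (v : Finset (Fin n)) :
    varIdeal K v = Ideal.span (MvPolynomial.X '' (v : Set (Fin n))) := by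
  simp [varIdeal, purePowerIdeal]

theorem notMem_monomialExponents_varIdeal {v : Finset (Fin n)} {d : Fin n →₀ ℕ} :
    d ∉ monomialExponents (varIdeal K v) ↔ ∀ j ∈ v, d j = 0 := by
  rw [mem_monomialExponents_purePowerIdeal]
  simp

theorem not_le_varIdeal_iff {I : Ideal (MvPolynomial (Fin n) K)} (hI : IsMonomialIdeal I)
    {v : Finset (Fin n)} :
    ¬ I ≤ varIdeal K v ↔ ∃ d ∈ monomialExponents I, ∀ j ∈ v, d j = 0 := by
  simp_rw [hI.le_iff, Set.not_subset, notMem_monomialExponents_varIdeal]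

theorem X_mem_varIdeal {v : Finset (Fin n)} {j : Fin n} :
    (MvPolynomial.X j : MvPolynomial (Fin n) K) ∈ varIdeal K v ↔ j ∈ v := by
  classical
  have := mem_monomialExponents_purePowerIdeal (K := K) (v := v) (a := 1)
    (d := Finsupp.single j 1)
  rw [MvPolynomial.X]
  refine this.trans ?_
  simp only [Pi.one_apply, Finsupp.single_apply]
  constructor
  · rintro ⟨i, hi, h⟩
    split_ifs at h with h'
    · rwa [h']
    · omega
  · exact fun h => ⟨j, h, by simp⟩

/-- If `f` were outside, some monomial of `g` outside the prime times some monomial of `f` outside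
the ideal would survive in the product. This gives primariness, and primality of `varIdeal` when all
exponents are 1. -/
theorem mem_purePowerIdeal_of_mul_mem {v : Finset (Fin n)} {a : Fin n → ℕ}
    {f g : MvPolynomial (Fin n) K} (hg : g ∉ varIdeal K v) (hgf : g * f ∈ purePowerIdeal K v a) :
    f ∈ purePowerIdeal K v a := by
  classical
  by_contra hf
  rw [(isMonomialIdeal_purePowerIdeal v 1).mem_iff] at hg
  rw [(isMonomialIdeal_purePowerIdeal v a).mem_iff] at hf
  push Not at hg hf
  simp only [notMem_monomialExponents_varIdeal] at hg
  simp only [mem_monomialExponents_purePowerIdeal, not_exists, not_and, not_le] at hf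
  set B := f.support.filter (fun b => ∀ j ∈ v, b j < a j) with hB
  have hBne : B.Nonempty := let ⟨b, hb, h⟩ := hf; ⟨b, Finset.mem_filter.2 ⟨hb, h⟩⟩
  set A := g.support.filter (fun b => ∀ j ∈ v, b j = 0) with hA
  have hAne : A.Nonempty := let ⟨b, hb, h⟩ := hg; ⟨b, Finset.mem_filter.2 ⟨hb, h⟩⟩
  -- Among the monomials of `f` outside the ideal, only those of least degree in the variables of
  -- `v` are kept; finite sets of exponents then have a sum attained only once.
  obtain ⟨b₀, hb₀, hmin⟩ := B.exists_min_image (fun b => ∑ j ∈ v, b j) hBne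
  obtain ⟨a₁, ha₁, b₁, hb₁, huniq⟩ := UniqueSums.uniqueAdd_of_nonempty hAne
    (show (B.filter (fun b => ∑ j ∈ v, b j = ∑ j ∈ v, b₀ j)).Nonempty from
      ⟨b₀, by simp [hb₀]⟩)
  have hb₁' := Finset.mem_filter.1 hb₁
  have hb₁B := Finset.mem_filter.1 hb₁'.1
  have ha₁' := Finset.mem_filter.1 ha₁
  -- Uniqueness extends to the full supports: `a₁` vanishes on `v`, so a competing `b'` is bounded
  -- by `b₁` on `v`, and minimality of the degree forces `a'` to vanish on `v`.
  have hU : UniqueAdd g.support f.support a₁ b₁ := by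
    intro a' b' ha' hb' hab
    have hj : ∀ j ∈ v, a' j + b' j = b₁ j := fun j hj => by
      have := DFunLike.congr_fun hab j
      simpa [ha₁'.2 j hj] using this
    have hb'B : b' ∈ B := Finset.mem_filter.2 ⟨hb', fun j hjv => by
      have := hj j hjv
      have := hb₁B.2 j hjv
      omega⟩
    have hsum : ∑ j ∈ v, a' j + ∑ j ∈ v, b' j = ∑ j ∈ v, b₀ j := by
      rw [← Finset.sum_add_distrib, ← hb₁'.2]
      exact Finset.sum_congr rfl hj
    have hm := hmin b' hb'B
    have h0 : ∑ j ∈ v, a' j = 0 := by omega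
    refine huniq (Finset.mem_filter.2 ⟨ha', fun j hjv => ?_⟩)
      (Finset.mem_filter.2 ⟨hb'B, by omega⟩) hab
    exact Finset.sum_eq_zero_iff.1 h0 j hjv
  have hcoeff : (g * f).coeff (a₁ + b₁) = g.coeff a₁ * f.coeff b₁ :=
    AddMonoidAlgebra.coeff_mul_add_of_uniqueAdd hU
  have hmem : a₁ + b₁ ∈ (g * f).support := by
    rw [MvPolynomial.mem_support_iff, hcoeff]
    exact mul_ne_zero (MvPolynomial.mem_support_iff.1 ha₁'.1)
      (MvPolynomial.mem_support_iff.1 hb₁B.1)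
  have := (isMonomialIdeal_purePowerIdeal v a).mem_iff.1 hgf _ hmem
  obtain ⟨j, hjv, hj⟩ := mem_monomialExponents_purePowerIdeal.1 this
  have := hb₁B.2 j hjv
  have := ha₁'.2 j hjv
  simp only [Finsupp.add_apply] at hj
  omega

instance isPrime_varIdeal (v : Finset (Fin n)) : (varIdeal K v).IsPrime where
  ne_top' := by
    rw [Ne, Ideal.eq_top_iff_one]
    intro h
    have h0 : (0 : Fin n →₀ ℕ) ∉ monomialExponents (varIdeal K v) := by
      simp [notMem_monomialExponents_varIdeal]
    exact h0 h
  mem_or_mem' := by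
    intro f g hfg
    by_contra! h
    exact h.2 (mem_purePowerIdeal_of_mul_mem h.1 hfg)

theorem varIdeal_le_iff {v : Finset (Fin n)} {P : Ideal (MvPolynomial (Fin n) K)} :
    varIdeal K v ≤ P ↔ ∀ j ∈ v, MvPolynomial.X j ∈ P := by
  rw [varIdeal_eq, Ideal.span_le, Set.image_subset_iff]
  rfl

theorem subset_of_purePowerIdeal_le_varIdeal {v w : Finset (Fin n)} {a : Fin n → ℕ} :
    purePowerIdeal K v a ≤ varIdeal K w → v ⊆ w := by
  intro h j hj
  have : (MvPolynomial.X j : MvPolynomial (Fin n) K) ^ a j ∈ varIdeal K w :=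
    h (Ideal.subset_span ⟨j, hj, rfl⟩)
  exact X_mem_varIdeal.1 (Ideal.IsPrime.mem_of_pow_mem inferInstance _ this)

theorem purePowerIdeal_le_varIdeal {v : Finset (Fin n)} {a : Fin n → ℕ} (ha : ∀ j ∈ v, 0 < a j) :
    purePowerIdeal K v a ≤ varIdeal K v := by
  rw [(isMonomialIdeal_purePowerIdeal v a).le_iff]
  intro d hd
  obtain ⟨j, hj, h⟩ := mem_monomialExponents_purePowerIdeal.1 hd
  exact mem_monomialExponents_purePowerIdeal.2 ⟨j, hj, (ha j hj).trans_le h⟩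

/-- The upper bound is Krull's height theorem; the lower bound comes from the chain of primes
obtained by adding one variable at a time. -/
theorem height_varIdeal (v : Finset (Fin n)) : (varIdeal K v).height = v.card := by
  classical
  apply le_antisymm
  · have := Ideal.height_le_card_of_mem_minimalPrimes_span_finset (p := varIdeal K v)
      (s := v.image MvPolynomial.X) (by
        rw [Finset.coe_image, ← varIdeal_eq, Ideal.minimalPrimes_eq_subsingleton_self]
        rfl)
    exact this.trans (by exact_mod_cast Finset.card_image_le)
  · induction v using Finset.induction_on with
    | empty => simp
    | insert j v hj ih =>
      rw [Finset.card_insert_of_notMem hj, Nat.cast_add, Nat.cast_one]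
      have hlt : varIdeal K v < varIdeal K (insert j v) := by
        refine lt_of_le_of_ne (varIdeal_le_iff.2 fun i hi =>
          X_mem_varIdeal.2 (Finset.mem_insert_of_mem hi)) fun h => hj ?_
        rw [← X_mem_varIdeal (K := K), h]
        exact X_mem_varIdeal.2 (Finset.mem_insert_self _ _)
      exact (add_le_add_left ih 1).trans (Ideal.height_add_one_le_of_lt_of_isPrime hlt)

/-- Given monomials of `J₁` and `J₂` outside the ideal, their lcm lies in both but still has all
exponents on `v` below the bounds. -/
theorem isIrreducibleMonomialIdeal_purePowerIdeal {v : Finset (Fin n)} {a : Fin n → ℕ}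
    (ha : ∀ j ∈ v, 0 < a j) : IsIrreducibleMonomialIdeal (purePowerIdeal K v a) := by
  refine ⟨isMonomialIdeal_purePowerIdeal v a, fun h => ?_, fun J₁ J₂ h₁ h₂ hJ => ?_⟩
  · exact Ideal.IsPrime.ne_top (isPrime_varIdeal (K := K) v)
      (top_le_iff.1 (h ▸ purePowerIdeal_le_varIdeal ha))
  · by_contra! hne
    have key : ∀ J : Ideal (MvPolynomial (Fin n) K), IsMonomialIdeal J →
        purePowerIdeal K v a ≤ J → purePowerIdeal K v a ≠ J →
        ∃ b ∈ monomialExponents J, ∀ j ∈ v, b j < a j := by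
      intro J hJm hle hne
      by_contra! hcon
      exact hne (le_antisymm hle (hJm.le_iff.2 fun b hb =>
        mem_monomialExponents_purePowerIdeal.2 (hcon b hb)))
    obtain ⟨b₁, hb₁, hlt₁⟩ := key J₁ h₁ (hJ ▸ inf_le_left) hne.1
    obtain ⟨b₂, hb₂, hlt₂⟩ := key J₂ h₂ (hJ ▸ inf_le_right) hne.2
    have hmem : b₁ ⊔ b₂ ∈ monomialExponents (purePowerIdeal K v a) := by
      rw [hJ]
      exact ⟨isUpperSet_monomialExponents J₁ le_sup_left hb₁,
        isUpperSet_monomialExponents J₂ le_sup_right hb₂⟩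
    obtain ⟨j, hj, h⟩ := mem_monomialExponents_purePowerIdeal.1 hmem
    have := hlt₁ j hj
    have := hlt₂ j hj
    rw [Finsupp.sup_apply] at h
    have := max_lt ‹b₁ j < a j› ‹b₂ j < a j›
    omega

end PurePowers

/-! ### Isolated primary components -/

/-- In a minimal primary decomposition, the component belonging to a minimal prime `P` consists of
the elements that are multiplied into the ideal by some element outside `P`. -/
theorem Submodule.IsMinimalPrimaryDecomposition.exists_isolated_component {R : Type*} [CommRing R]
    {I P : Ideal R} {t : Finset (Ideal R)} (ht : Submodule.IsMinimalPrimaryDecomposition I t)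
    (hP : P ∈ I.minimalPrimes) :
    ∃ Q ∈ t, Q.radical = P ∧ ∀ x, x ∈ Q ↔ ∃ g ∉ P, g * x ∈ I := by
  classical
  obtain ⟨Q, hQ, hrad⟩ := Ideal.IsMinimalPrimaryDecomposition.minimalPrimes_subset_image_radical
    ht hP
  have hPprime : P.IsPrime := hP.1.1
  refine ⟨Q, hQ, hrad, fun x => ⟨fun hx => ?_, ?_⟩⟩
  -- If `P` contained the intersection of the other components it would contain one of them, whose
  -- radical would be `P` by minimality, contradicting distinct radicals.
  · have hnot : ¬ (t.erase Q).inf id ≤ P := by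
      rw [Ideal.IsPrime.inf_le' hPprime]
      rintro ⟨Q', hQ', hle⟩
      obtain ⟨hne, hQ't⟩ := Finset.mem_erase.1 hQ'
      have h1 : Q'.radical ≤ P := hPprime.radical_le_iff.2 hle
      have hI : I ≤ Q' := ht.inf_eq ▸ Finset.inf_le hQ't
      have h2 : P ≤ Q'.radical :=
        hP.2 ⟨Ideal.isPrime_radical (ht.primary hQ't), hI.trans Ideal.le_radical⟩ h1
      refine ht.distinct hQ't hQ hne ?_
      simp only [Submodule.colon_univ, hrad]
      exact le_antisymm h1 h2
    obtain ⟨g, hg, hgP⟩ := SetLike.not_le_iff_exists.1 hnot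
    refine ⟨g, hgP, ?_⟩
    rw [← ht.inf_eq, ← Finset.insert_erase hQ, Finset.inf_insert]
    exact ⟨Q.mul_mem_left g hx, Ideal.mul_mem_right x _ hg⟩
  · rintro ⟨g, hg, hgx⟩
    have hmem : x * g ∈ Q := by
      rw [mul_comm]
      exact (ht.inf_eq ▸ Finset.inf_le hQ : I ≤ Q) hgx
    refine ((Ideal.isPrimary_iff.1 (ht.primary hQ)).2 hmem).resolve_right ?_
    rwa [hrad]

theorem Ideal.height_eq_of_isPrime_le_iff {R : Type*} [CommRing R] {I J : Ideal R}
    (h : ∀ P : Ideal R, P.IsPrime → (I ≤ P ↔ J ≤ P)) : I.height = J.height := by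
  have key : ∀ I J : Ideal R, (∀ P : Ideal R, P.IsPrime → (I ≤ P ↔ J ≤ P)) →
      I.height ≤ J.height := by
    intro I J h
    rw [J.height_eq_inf_minimalPrimes]
    exact le_iInf₂ fun p hp => Ideal.height_mono ((h p hp.1.1).2 hp.1.2)
  exact le_antisymm (key I J h) (key J I fun P hP => (h P hP).symm)

/-! ### Localization at monomial primes and the local form of (∗) -/

section LocalExponents

variable {K : Type*} [Field K] {n : ℕ}

/-- The exponent vectors of the monomials belonging to the localization of `I` at the prime ideal
generated by the variables in `v`. -/
def localExponents (I : Ideal (MvPolynomial (Fin n) K)) (v : Finset (Fin n)) :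
    Set (Fin n →₀ ℕ) :=
  {d | ∃ c : Fin n →₀ ℕ, (∀ j ∈ v, c j = 0) ∧ d + c ∈ monomialExponents I}

/-- Multiplication by a monomial shifts the support of `g` without cancellation, so any monomial of
`g` outside the prime can replace `g`. This links local exponents to isolated components. -/
theorem IsMonomialIdeal.mem_localExponents_iff {I : Ideal (MvPolynomial (Fin n) K)}
    (hI : IsMonomialIdeal I) {v : Finset (Fin n)} {d : Fin n →₀ ℕ} :
    d ∈ localExponents I v ↔
      ∃ g ∉ varIdeal K v, g * MvPolynomial.monomial d (1 : K) ∈ I := by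
  constructor
  · rintro ⟨c, hc, hmem⟩
    refine ⟨MvPolynomial.monomial c 1, notMem_monomialExponents_varIdeal.2 hc, ?_⟩
    rw [MvPolynomial.monomial_mul, one_mul, add_comm]
    exact hmem
  · rintro ⟨g, hg, hmem⟩
    rw [(isMonomialIdeal_purePowerIdeal v 1).mem_iff] at hg
    push Not at hg
    obtain ⟨c, hc, hcv⟩ := hg
    refine ⟨c, notMem_monomialExponents_varIdeal.1 hcv, ?_⟩
    rw [add_comm]
    refine hI.mem_iff.1 hmem _ ?_
    rw [MvPolynomial.mem_support_iff, MvPolynomial.coeff_mul_monomial, mul_one]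
    exact MvPolynomial.mem_support_iff.1 hc

/-- Take all variables lying in `P`: each monomial of `I` lies in `P`, hence so does one of the
variables dividing it. -/
theorem IsMonomialIdeal.exists_varIdeal_le {I P : Ideal (MvPolynomial (Fin n) K)}
    (hI : IsMonomialIdeal I) [hP : P.IsPrime] (h : I ≤ P) :
    ∃ v : Finset (Fin n), I ≤ varIdeal K v ∧ varIdeal K v ≤ P := by
  classical
  refine ⟨Finset.univ.filter fun j => MvPolynomial.X j ∈ P, ?_,
    varIdeal_le_iff.2 fun j hj => (Finset.mem_filter.1 hj).2⟩
  by_contra hcon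
  obtain ⟨d, hd, hd0⟩ := (not_le_varIdeal_iff hI).1 hcon
  have hmem := h hd
  rw [MvPolynomial.monomial_eq, map_one, one_mul, Finsupp.prod, hP.prod_mem_iff] at hmem
  obtain ⟨j, hj, hjP⟩ := hmem
  exact Finsupp.mem_support_iff.1 hj
    (hd0 j (Finset.mem_filter.2 ⟨Finset.mem_univ _, hP.mem_of_pow_mem _ hjP⟩))

theorem varIdeal_mem_minimalPrimes {I : Ideal (MvPolynomial (Fin n) K)} {v : Finset (Fin n)}
    (hI : I.height = v.card) (hle : I ≤ varIdeal K v) : varIdeal K v ∈ I.minimalPrimes :=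
  Ideal.mem_minimalPrimes_of_height_le hle (by rw [hI, height_varIdeal])

/-- The component at this minimal prime has height `h`, so it is generated by pure powers; its
variables lie in `v`, and there are `h` of them, so they are all of `v`. -/
theorem HasIrreducibleTopComponents.exists_localExponents_iff
    {I : Ideal (MvPolynomial (Fin n) K)} {h : ℕ} (hI : HasIrreducibleTopComponents I h)
    {v : Finset (Fin n)} (hv : v.card = h) (hle : I ≤ varIdeal K v) :
    ∃ a : Fin n → ℕ, (∀ j ∈ v, 0 < a j) ∧ ∀ d, d ∈ localExponents I v ↔ ∃ j ∈ v, a j ≤ d j := by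
  obtain ⟨t, ht, hge, htop⟩ := hI.exists_decomposition
  obtain ⟨Q, hQ, hrad, hmem⟩ := ht.exists_isolated_component
    (varIdeal_mem_minimalPrimes (by rw [hI.height_eq, hv]) hle)
  have hQle : Q ≤ varIdeal K v := hrad ▸ Ideal.le_radical
  have hQh : Q.height = h := le_antisymm
    ((Ideal.height_mono hQle).trans (by rw [height_varIdeal, hv])) (hge Q hQ)
  obtain ⟨w, a, hw, ha, hQeq⟩ := (htop Q hQ hQh).2
  obtain rfl : w = v := Finset.eq_of_subset_of_card_le
    (subset_of_purePowerIdeal_le_varIdeal (a := a) (hQeq ▸ hQle)) (by omega)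
  refine ⟨a, ha, fun d => ?_⟩
  rw [hI.isMonomialIdeal.mem_localExponents_iff, ← hmem, hQeq]
  exact mem_monomialExponents_purePowerIdeal

/-- Any minimal primary decomposition will do: a component of height `h` is isolated, so the local
exponents determine it. -/
theorem IsMonomialIdeal.hasIrreducibleTopComponents {I : Ideal (MvPolynomial (Fin n) K)} {h : ℕ}
    (hI : IsMonomialIdeal I) (hh : I.height = h)
    (hloc : ∀ v : Finset (Fin n), v.card = h → I ≤ varIdeal K v →
      ∃ a : Fin n → ℕ, (∀ j ∈ v, 0 < a j) ∧
        ∀ d, d ∈ localExponents I v ↔ ∃ j ∈ v, a j ≤ d j) :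
    HasIrreducibleTopComponents I h := by
  obtain ⟨t, ht⟩ := Submodule.IsLasker.exists_isMinimalPrimaryDecomposition
    (Submodule.isLasker (MvPolynomial (Fin n) K) (MvPolynomial (Fin n) K)) I
  have hIQ : ∀ Q ∈ t, I ≤ Q := fun Q hQ => ht.inf_eq ▸ Finset.inf_le hQ
  refine ⟨hI, hh, t, ht, fun Q hQ => hh ▸ Ideal.height_mono (hIQ Q hQ), fun Q hQ hQh => ?_⟩
  have hPprime := Ideal.isPrime_radical (ht.primary hQ)
  obtain ⟨v, hIv, hvP⟩ := hI.exists_varIdeal_le ((hIQ Q hQ).trans Q.le_radical)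
  have hrad : Q.radical.height = h := by
    refine le_antisymm ?_ (hQh ▸ Ideal.height_mono Q.le_radical)
    obtain ⟨p, hp, hQp, hph⟩ := Ideal.exists_isPrime_height_eq hQh
    exact hph ▸ Ideal.height_mono (hp.radical_le_iff.2 hQp)
  -- The monomial prime inside the radical contains `I`, so it already has height at least `h`, and
  -- the inclusion cannot be strict.
  have hvP' : varIdeal K v = Q.radical :=
    Ideal.eq_of_le_of_height_le _ hvP (by rw [hrad, ← hh]; exact Ideal.height_mono hIv)
  have hv : v.card = h := by
    rw [← hvP', height_varIdeal] at hrad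
    exact_mod_cast hrad
  obtain ⟨a, ha, hiff⟩ := hloc v hv hIv
  obtain ⟨Q', hQ', hrad', hmem⟩ := ht.exists_isolated_component
    (varIdeal_mem_minimalPrimes (by rw [hh, hv]) hIv)
  obtain rfl : Q' = Q := by
    by_contra hne
    refine ht.distinct hQ' hQ hne ?_
    simp only [Submodule.colon_univ, hrad', hvP']
  have hQeq : Q' = purePowerIdeal K v a := by
    apply le_antisymm
    · intro f hf
      obtain ⟨g, hg, hgf⟩ := (hmem f).1 hf
      refine mem_purePowerIdeal_of_mul_mem hg ?_
      refine (hI.le_iff.2 fun d hd => ?_ : I ≤ _) hgf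
      exact mem_monomialExponents_purePowerIdeal.2 ((hiff d).1 ⟨0, by simp, by simpa using hd⟩)
    · rw [(isMonomialIdeal_purePowerIdeal v a).le_iff]
      intro d hd
      rw [mem_monomialExponents, hmem, ← hI.mem_localExponents_iff, hiff]
      exact mem_monomialExponents_purePowerIdeal.1 hd
  rw [hQeq]
  exact ⟨isIrreducibleMonomialIdeal_purePowerIdeal ha, v, a, hv, ha, rfl⟩

theorem IsMonomialIdeal.specialPower_le_iff {I P : Ideal (MvPolynomial (Fin n) K)}
    (hI : IsMonomialIdeal I) (hP : P.IsPrime) {m : ℕ} (hm : 1 ≤ m) :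
    specialPower I m ≤ P ↔ I ≤ P :=
  ⟨hI.le_of_specialPower_le, (specialPower_le hm).trans⟩

theorem mem_localExponents_specialPower {I : Ideal (MvPolynomial (Fin n) K)} {v : Finset (Fin n)}
    {a : Fin n → ℕ} (ha : ∀ d, d ∈ localExponents I v ↔ ∃ j ∈ v, a j ≤ d j) (m : ℕ)
    (d : Fin n →₀ ℕ) :
    d ∈ localExponents (specialPower I m) v ↔ ∃ j ∈ v, m * a j ≤ d j := by
  constructor
  · rintro ⟨c, hc, hmem⟩
    obtain ⟨b, hb, hle⟩ := mem_monomialExponents_specialPower.1 hmem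
    obtain ⟨j, hj, hab⟩ := (ha b).1 ⟨0, by simp, by simpa using hb⟩
    refine ⟨j, hj, (Nat.mul_le_mul_left m hab).trans ?_⟩
    simpa [hc j hj] using hle j
  · rintro ⟨j, hj, hle⟩
    obtain ⟨c, hc, hmem⟩ := (ha (Finsupp.single j (a j))).2 ⟨j, hj, by simp⟩
    refine ⟨m • c, fun i hi => by simp [hc i hi], ?_⟩
    refine mem_monomialExponents_specialPower.2 ⟨_, hmem, ?_⟩
    rw [smul_add]
    refine add_le_add_left ?_ _
    rw [Finsupp.smul_single, Finsupp.single_le_iff]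
    simpa using hle

/-- The sum of quotients is the largest number of factors x_j^{b_j}, repetitions allowed, whose
product divides the monomial. The induction strips one factor at a time. -/
theorem IsMonomialIdeal.mem_localExponents_pow {I : Ideal (MvPolynomial (Fin n) K)}
    (hI : IsMonomialIdeal I) {v : Finset (Fin n)} {b : Fin n → ℕ} (hb : ∀ j ∈ v, 0 < b j)
    (hloc : ∀ d, d ∈ localExponents I v ↔ ∃ j ∈ v, b j ≤ d j) (s : ℕ) (d : Fin n →₀ ℕ) :
    d ∈ localExponents (I ^ s) v ↔ s ≤ ∑ j ∈ v, d j / b j := by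
  classical
  induction s generalizing d with
  | zero => simpa using ⟨0, by simp, by simp [monomialExponents]⟩
  | succ s ih =>
    constructor
    · rintro ⟨c, hc, hmem⟩
      rw [pow_succ, (hI.pow s).mem_monomialExponents_mul hI] at hmem
      obtain ⟨e₁, he₁, e₂, he₂, heq⟩ := hmem
      have h1 := (ih e₁).1 ⟨0, by simp, by simpa using he₁⟩
      obtain ⟨j, hj, h2⟩ := (hloc e₂).1 ⟨0, by simp, by simpa using he₂⟩
      have h3 : 1 ≤ ∑ j ∈ v, e₂ j / b j :=
        ((Nat.one_le_div_iff (hb j hj)).2 h2).trans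
          (Finset.single_le_sum (f := fun j => e₂ j / b j) (fun _ _ => Nat.zero_le _) hj)
      calc s + 1 ≤ ∑ j ∈ v, e₁ j / b j + ∑ j ∈ v, e₂ j / b j := add_le_add h1 h3
        _ = ∑ j ∈ v, (e₁ j / b j + e₂ j / b j) := Finset.sum_add_distrib.symm
        _ ≤ ∑ j ∈ v, d j / b j := by
          refine Finset.sum_le_sum fun i hi => ?_
          have : d i = e₁ i + e₂ i := by
            have := DFunLike.congr_fun heq i
            simpa [hc i hi] using this
          rw [this]
          exact Nat.div_add_div_le_add_div
    · intro hs
      obtain ⟨j, hj, hpos⟩ : ∃ j ∈ v, 0 < d j / b j := by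
        by_contra! hcon
        have := Finset.sum_nonpos hcon
        omega
      have hle : b j ≤ d j := by
        by_contra! hlt
        rw [Nat.div_eq_of_lt hlt] at hpos
        exact hpos.false
      obtain ⟨e, rfl⟩ := exists_add_of_le (Finsupp.single_le_iff.2 hle)
      have hsum : ∑ i ∈ v, (Finsupp.single j (b j) + e) i / b i = ∑ i ∈ v, e i / b i + 1 := by
        rw [← Finset.add_sum_erase v _ hj, ← Finset.add_sum_erase v (fun i => e i / b i) hj]
        have : ∑ i ∈ v.erase j, (Finsupp.single j (b j) + e) i / b i =
            ∑ i ∈ v.erase j, e i / b i := by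
          refine Finset.sum_congr rfl fun i hi => ?_
          rw [Finsupp.add_apply, Finsupp.single_eq_of_ne (Finset.ne_of_mem_erase hi), zero_add]
        rw [this, Finsupp.add_apply, Finsupp.single_eq_same, Nat.add_div_left _ (hb j hj)]
        omega
      rw [hsum] at hs
      obtain ⟨c₁, hc₁, h₁⟩ := (ih e).2 (by omega)
      obtain ⟨c₂, hc₂, h₂⟩ := (hloc (Finsupp.single j (b j))).2 ⟨j, hj, by simp⟩
      refine ⟨c₁ + c₂, fun i hi => by simp [hc₁ i hi, hc₂ i hi], ?_⟩
      rw [pow_succ]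
      have := add_mem_monomialExponents_mul h₁ h₂
      rwa [show Finsupp.single j (b j) + e + (c₁ + c₂) =
        e + c₁ + (Finsupp.single j (b j) + c₂) by abel]

end LocalExponents

theorem HasIrreducibleTopComponents.specialPower {K : Type*} [Field K] {n : ℕ}
    {I : Ideal (MvPolynomial (Fin n) K)} {h : ℕ} (hI : HasIrreducibleTopComponents I h) {m : ℕ}
    (hm : 1 ≤ m) : HasIrreducibleTopComponents (specialPower I m) h := by
  refine (isMonomialIdeal_specialPower I m).hasIrreducibleTopComponents ?_ fun v hv hle => ?_
  · rw [← hI.height_eq]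
    exact Ideal.height_eq_of_isPrime_le_iff fun P hP =>
      hI.isMonomialIdeal.specialPower_le_iff hP hm
  · obtain ⟨a, ha, hloc⟩ := hI.exists_localExponents_iff hv
      ((hI.isMonomialIdeal.specialPower_le_iff inferInstance hm).1 hle)
    exact ⟨fun j => m * a j, fun j hj => Nat.mul_pos hm (ha j hj),
      mem_localExponents_specialPower hloc m⟩

/-! ### Krull dimension of monomial quotients -/

/-- A chain of primes over `I` starts at a prime of height at least `h`, and height plus coheight is
at most the dimension of `R`. -/
theorem Ideal.ringKrullDim_quotient_le_sub {R : Type*} [CommRing R] {I : Ideal R}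
    {h m : ℕ} (hh : (h : ℕ∞) ≤ I.height) (hR : ringKrullDim R ≤ (m : ℕ)) :
    ringKrullDim (R ⧸ I) ≤ ((m - h : ℕ) : WithBot ℕ∞) := by
  rw [ringKrullDim_quotient, Order.krullDim]
  refine iSup_le fun l => ?_
  set p : PrimeSpectrum R := (l.head : PrimeSpectrum R)
  have hp : (h : ℕ∞) ≤ Order.height p := by
    rw [← p.height_eq_orderHeight]
    exact hh.trans (Ideal.height_mono l.head.2)
  have hl : (l.length : ℕ∞) ≤ Order.coheight p :=
    Order.length_le_coheight (p := l.map Subtype.val (fun _ _ h => h)) le_rfl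
  have : Nonempty (PrimeSpectrum R) := ⟨p⟩
  have hsum : ((h + l.length : ℕ) : WithBot ℕ∞) ≤ (m : ℕ) := by
    refine le_trans ?_ hR
    rw [ringKrullDim, Order.krullDim_eq_iSup_height_add_coheight_of_nonempty]
    have h1 : ((h + l.length : ℕ) : ℕ∞) ≤ Order.height p + Order.coheight p := by
      push_cast
      exact add_le_add hp hl
    have h2 := h1.trans (le_iSup (fun a : PrimeSpectrum R => Order.height a + Order.coheight a) p)
    exact_mod_cast h2
  have : h + l.length ≤ m := by exact_mod_cast hsum
  have : l.length ≤ m - h := by omega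
  exact_mod_cast this

section Dimension

variable {K : Type*} [Field K] {n : ℕ}

theorem card_sub_le_ringKrullDim_quotient_varIdeal (v : Finset (Fin n)) :
    ((n - v.card : ℕ) : WithBot ℕ∞) ≤ ringKrullDim (MvPolynomial (Fin n) K ⧸ varIdeal K v) := by
  classical
  let φ : MvPolynomial (Fin n) K →ₐ[K] MvPolynomial {j // j ∉ v} K :=
    MvPolynomial.aeval fun j => if hj : j ∉ v then MvPolynomial.X ⟨j, hj⟩ else 0
  have hφ : ∀ f ∈ varIdeal K v, φ.toRingHom f = 0 := by
    intro f hf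
    have : varIdeal K v ≤ RingHom.ker φ.toRingHom :=
      varIdeal_le_iff.2 fun j hj => by simp [RingHom.mem_ker, φ, hj]
    exact this hf
  have hsurj : Function.Surjective φ.toRingHom := by
    intro g
    refine ⟨MvPolynomial.rename Subtype.val g, ?_⟩
    change φ _ = g
    rw [MvPolynomial.aeval_rename]
    have : (fun j => if hj : j ∉ v then MvPolynomial.X ⟨j, hj⟩ else 0) ∘ Subtype.val =
        (MvPolynomial.X : {j // j ∉ v} → MvPolynomial {j // j ∉ v} K) := by
      funext j
      simp [j.2]
    rw [this, MvPolynomial.aeval_X_left_apply]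
  have := ringKrullDim_le_of_surjective (Ideal.Quotient.lift _ φ.toRingHom hφ)
    (Ideal.Quotient.lift_surjective_of_surjective _ hφ hsurj)
  refine le_trans (le_of_eq ?_) this
  rw [MvPolynomial.ringKrullDim_of_isNoetherianRing, ringKrullDim_eq_zero_of_field, zero_add,
    Nat.card_eq_fintype_card, Fintype.card_subtype_compl]
  simp

theorem IsMonomialIdeal.exists_le_varIdeal {I : Ideal (MvPolynomial (Fin n) K)}
    (hI : IsMonomialIdeal I) {h : ℕ} (hh : I.height = h) :
    ∃ v : Finset (Fin n), v.card = h ∧ I ≤ varIdeal K v := by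
  obtain ⟨P, hP, hIP, hPh⟩ := Ideal.exists_isPrime_height_eq hh
  obtain ⟨v, hIv, hvP⟩ := hI.exists_varIdeal_le hIP
  refine ⟨v, le_antisymm ?_ ?_, hIv⟩
  · have := Ideal.height_mono hvP
    rw [height_varIdeal, hPh] at this
    exact_mod_cast this
  · have := Ideal.height_mono hIv
    rw [height_varIdeal, hh] at this
    exact_mod_cast this

theorem IsMonomialIdeal.ringKrullDim_quotient {I : Ideal (MvPolynomial (Fin n) K)}
    (hI : IsMonomialIdeal I) {h : ℕ} (hh : I.height = h) :
    ringKrullDim (MvPolynomial (Fin n) K ⧸ I) = ((n - h : ℕ) : WithBot ℕ∞) := by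
  apply le_antisymm
  · refine Ideal.ringKrullDim_quotient_le_sub hh.ge ?_
    rw [MvPolynomial.ringKrullDim_of_isNoetherianRing, ringKrullDim_eq_zero_of_field, zero_add,
      Nat.card_fin]
  · obtain ⟨v, hv, hle⟩ := hI.exists_le_varIdeal hh
    have h1 := card_sub_le_ringKrullDim_quotient_varIdeal (K := K) v
    rw [hv] at h1
    exact h1.trans (ringKrullDim_le_of_surjective (Ideal.Quotient.factor hle)
      (Ideal.Quotient.factor_surjective hle))

end Dimension

/-! ### Standard monomials and the Hilbert function -/

section HilbertFunction

variable {K : Type*} [Field K] {n : ℕ}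

/-- A monomial ideal contains every monomial of each of its elements, so no relation is possible.
The predicate `p` is later a degree condition for the Hilbert function, and `True` for the length.
-/
theorem IsMonomialIdeal.linearIndependent_mk {I : Ideal (MvPolynomial (Fin n) K)}
    (hI : IsMonomialIdeal I) (p : (Fin n →₀ ℕ) → Prop) :
    LinearIndependent K (fun d : {d // d ∉ monomialExponents I ∧ p d} =>
      Ideal.Quotient.mkₐ K I (MvPolynomial.monomial d.1 (1 : K))) := by
  classical
  rw [linearIndependent_iff']
  intro s g hg i hi
  by_contra hne
  have hmem : ∑ j ∈ s, MvPolynomial.monomial j.1 (g j) ∈ I := by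
    rw [← Ideal.Quotient.eq_zero_iff_mem, ← Ideal.Quotient.mkₐ_eq_mk K, map_sum, ← hg]
    refine Finset.sum_congr rfl fun j _ => ?_
    rw [← map_smul, MvPolynomial.smul_monomial, smul_eq_mul, mul_one]
  refine i.2.1 (hI.mem_iff.1 hmem i.1 ?_)
  rw [MvPolynomial.mem_support_iff, MvPolynomial.coeff_sum]
  simp only [MvPolynomial.coeff_monomial]
  rw [Finset.sum_eq_single i]
  · simpa using hne
  · intro b _ hb
    rw [if_neg fun h => hb (Subtype.ext h)]
  · exact fun h => absurd hi h

theorem IsMonomialIdeal.map_mk_eq_span {I : Ideal (MvPolynomial (Fin n) K)}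
    (p : (Fin n →₀ ℕ) → Prop) (W : Submodule K (MvPolynomial (Fin n) K))
    (hW : ∀ f ∈ W, ∀ d ∈ f.support, p d) (hp : ∀ d, p d → MvPolynomial.monomial d 1 ∈ W) :
    W.map (Ideal.Quotient.mkₐ K I).toLinearMap =
      Submodule.span K (Set.range fun d : {d // d ∉ monomialExponents I ∧ p d} =>
        Ideal.Quotient.mkₐ K I (MvPolynomial.monomial d.1 (1 : K))) := by
  apply le_antisymm
  · rintro _ ⟨f, hf, rfl⟩
    rw [f.as_sum, map_sum]
    refine Submodule.sum_mem _ fun d hd => ?_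
    have : MvPolynomial.monomial d (f.coeff d) =
        f.coeff d • MvPolynomial.monomial d (1 : K) := by
      rw [MvPolynomial.smul_monomial, smul_eq_mul, mul_one]
    rw [this, map_smul]
    refine Submodule.smul_mem _ _ ?_
    by_cases hdI : d ∈ monomialExponents I
    · have h0 : (Ideal.Quotient.mkₐ K I).toLinearMap (MvPolynomial.monomial d (1 : K)) = 0 :=
        Ideal.Quotient.eq_zero_iff_mem.2 hdI
      rw [h0]
      exact Submodule.zero_mem _
    · exact Submodule.subset_span ⟨⟨d, hdI, hW f hf d hd⟩, rfl⟩
  · rw [Submodule.span_le]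
    rintro _ ⟨d, rfl⟩
    exact ⟨_, hp d.1 d.2.2, rfl⟩

theorem IsMonomialIdeal.finrank_map_mk {I : Ideal (MvPolynomial (Fin n) K)}
    (hI : IsMonomialIdeal I) (p : (Fin n →₀ ℕ) → Prop)
    (hfin : {d | d ∉ monomialExponents I ∧ p d}.Finite)
    (W : Submodule K (MvPolynomial (Fin n) K))
    (hW : ∀ f ∈ W, ∀ d ∈ f.support, p d) (hp : ∀ d, p d → MvPolynomial.monomial d 1 ∈ W) :
    Module.finrank K (W.map (Ideal.Quotient.mkₐ K I).toLinearMap) =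
      {d | d ∉ monomialExponents I ∧ p d}.ncard := by
  have : Fintype {d // d ∉ monomialExponents I ∧ p d} := hfin.fintype
  rw [IsMonomialIdeal.map_mk_eq_span p W hW hp, finrank_span_eq_card (hI.linearIndependent_mk p),
    ← Nat.card_eq_fintype_card]
  rfl

theorem finite_degree_eq (k : ℕ) : {d : Fin n →₀ ℕ | d.degree = k}.Finite := by
  refine (Finset.finite_toSet (Finset.univ.finsuppAntidiag k)).subset fun d hd => ?_
  simp only [Finset.mem_coe, Finset.mem_finsuppAntidiag, Finset.subset_univ, and_true]
  rw [← hd, Finsupp.degree_eq_sum]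

theorem IsMonomialIdeal.hilbertFunction_eq {I : Ideal (MvPolynomial (Fin n) K)}
    (hI : IsMonomialIdeal I) (k : ℕ) :
    hilbertFunction I k = {d | d ∉ monomialExponents I ∧ d.degree = k}.ncard := by
  refine hI.finrank_map_mk (fun d => d.degree = k)
    ((finite_degree_eq k).subset fun d hd => hd.2) _ ?_ ?_
  · intro f hf d hd
    rw [MvPolynomial.mem_homogeneousSubmodule] at hf
    have := hf (MvPolynomial.mem_support_iff.1 hd)
    rw [Finsupp.degree_eq_weight_one]
    exact this
  · intro d hd
    exact MvPolynomial.isHomogeneous_monomial _ hd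

theorem IsMonomialIdeal.finite_quotient {I : Ideal (MvPolynomial (Fin n) K)}
    (hI : IsMonomialIdeal I) (hfin : (monomialExponents I)ᶜ.Finite) :
    Module.Finite K (MvPolynomial (Fin n) K ⧸ I) ∧
      Module.finrank K (MvPolynomial (Fin n) K ⧸ I) = (monomialExponents I)ᶜ.ncard := by
  have hset : {d | d ∉ monomialExponents I ∧ True} = (monomialExponents I)ᶜ := by ext; simp
  have hfin' : {d | d ∉ monomialExponents I ∧ True}.Finite := hset ▸ hfin
  have htop : (⊤ : Submodule K (MvPolynomial (Fin n) K)).map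
      (Ideal.Quotient.mkₐ K I).toLinearMap = ⊤ := by
    rw [Submodule.map_top, LinearMap.range_eq_top]
    exact Ideal.Quotient.mkₐ_surjective K I
  have hspan := IsMonomialIdeal.map_mk_eq_span (I := I) (fun _ => True) ⊤ (by simp) (by simp)
  have hrank := hI.finrank_map_mk (fun _ => True) hfin' ⊤ (by simp) (by simp)
  rw [htop] at hspan hrank
  rw [finrank_top, hset] at hrank
  refine ⟨⟨?_⟩, hrank⟩
  rw [hspan]
  have : Finite {d // d ∉ monomialExponents I ∧ True} := hfin'
  exact Submodule.fg_span (Set.finite_range _)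

end HilbertFunction

/-! ### Calculus of leading Hilbert coefficients -/

section HilbertPolynomial

/-- `f` agrees for large arguments with `∑_{i=0}^{d} (-1)^i cᵢ (k+d-i choose d-i)`, where `c₀ = e`
and all coefficients are integers. -/
def IsEventuallyHilbertPolynomial (d : ℕ) (e : ℤ) (f : ℕ → ℤ) : Prop :=
  ∃ c : ℕ → ℤ, c 0 = e ∧ ∀ᶠ k : ℕ in atTop, f k =
    ∑ i ∈ Finset.range (d + 1), (-1) ^ i * c i * ((k + (d - i)).choose (d - i) : ℤ)

namespace IsEventuallyHilbertPolynomial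

variable {d : ℕ} {e e' : ℤ} {f g : ℕ → ℤ}

theorem congr (hf : IsEventuallyHilbertPolynomial d e f) (h : ∀ᶠ k in atTop, g k = f k) :
    IsEventuallyHilbertPolynomial d e g := by
  obtain ⟨c, hc, hev⟩ := hf
  refine ⟨c, hc, ?_⟩
  filter_upwards [hev, h] with k h1 h2
  rw [h2, h1]

theorem zero (d : ℕ) : IsEventuallyHilbertPolynomial d 0 fun _ => 0 :=
  ⟨0, rfl, by simp⟩

theorem add (hf : IsEventuallyHilbertPolynomial d e f)
    (hg : IsEventuallyHilbertPolynomial d e' g) :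
    IsEventuallyHilbertPolynomial d (e + e') fun k => f k + g k := by
  obtain ⟨c, rfl, hc⟩ := hf
  obtain ⟨b, rfl, hb⟩ := hg
  refine ⟨c + b, rfl, ?_⟩
  filter_upwards [hc, hb] with k h1 h2
  rw [h1, h2, ← Finset.sum_add_distrib]
  refine Finset.sum_congr rfl fun i _ => ?_
  rw [Pi.add_apply]
  ring

theorem neg (hf : IsEventuallyHilbertPolynomial d e f) :
    IsEventuallyHilbertPolynomial d (-e) fun k => -f k := by
  obtain ⟨c, rfl, hc⟩ := hf
  refine ⟨-c, rfl, ?_⟩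
  filter_upwards [hc] with k h1
  rw [h1, ← Finset.sum_neg_distrib]
  refine Finset.sum_congr rfl fun i _ => ?_
  rw [Pi.neg_apply]
  ring

theorem sum {ι : Type*} (s : Finset ι) {e : ι → ℤ} {f : ι → ℕ → ℤ}
    (h : ∀ i ∈ s, IsEventuallyHilbertPolynomial d (e i) (f i)) :
    IsEventuallyHilbertPolynomial d (∑ i ∈ s, e i) fun k => ∑ i ∈ s, f i k := by
  classical
  induction s using Finset.induction_on with
  | empty => simpa using zero d
  | insert a s ha ih =>
    simp only [Finset.sum_insert ha]
    exact (h a (Finset.mem_insert_self a s)).add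
      (ih fun i hi => h i (Finset.mem_insert_of_mem hi))

theorem succ (hf : IsEventuallyHilbertPolynomial d e f) :
    IsEventuallyHilbertPolynomial (d + 1) 0 f := by
  obtain ⟨c, -, hc⟩ := hf
  -- Shifting the index by one changes the alternating sign, hence the minus.
  refine ⟨fun i => if i = 0 then 0 else -c (i - 1), rfl, ?_⟩
  filter_upwards [hc] with k h1
  rw [h1, Finset.sum_range_succ' _ (d + 1)]
  simp only [if_true, mul_zero, zero_mul, add_zero, Nat.succ_ne_zero, if_false,
    Nat.add_sub_cancel, Nat.add_sub_add_right]
  refine Finset.sum_congr rfl fun i _ => ?_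
  ring

theorem of_lt {D : ℕ} (hf : IsEventuallyHilbertPolynomial D e f) (h : D < d) :
    IsEventuallyHilbertPolynomial d 0 f := by
  induction d, h using Nat.le_induction with
  | base => exact hf.succ
  | succ d _ ih => exact ih.succ

/-- Pascal's rule: passing from `t` to `t + 1` subtracts a term of degree one lower, which leaves
the leading coefficient alone. Truncated subtraction is harmless once `k` exceeds `t`. -/
theorem choose_sub (D t : ℕ) :
    IsEventuallyHilbertPolynomial D 1 fun k => ((k - t + D).choose D : ℤ) := by
  induction t generalizing D with
  | zero =>
    refine ⟨fun i => if i = 0 then 1 else 0, rfl, Eventually.of_forall fun k => ?_⟩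
    rw [Finset.sum_eq_single 0 (fun i _ hi => by simp [hi]) (by simp)]
    simp
  | succ t ih =>
    cases D with
    | zero => simpa using ih 0
    | succ D =>
      have h := (ih (D + 1)).add ((ih D).neg.succ)
      rw [add_zero] at h
      refine h.congr ?_
      filter_upwards [eventually_ge_atTop (t + 1)] with k hk
      obtain ⟨q, rfl⟩ := Nat.exists_eq_add_of_le hk
      rw [show t + 1 + q - (t + 1) = q by omega, show t + 1 + q - t = q + 1 by omega,
        show q + 1 + (D + 1) = q + D + 1 + 1 by ring, Nat.choose_succ_succ (q + D + 1) D,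
        show q + 1 + D = q + D + 1 by ring, ← add_assoc]
      push_cast
      ring

theorem multichoose_sub {r : ℕ} (hr : r ≤ d + 1) (t : ℕ) :
    IsEventuallyHilbertPolynomial d (if r = d + 1 then 1 else 0)
      fun k => (Nat.multichoose r (k - t) : ℤ) := by
  cases r with
  | zero =>
    rw [if_neg (Nat.succ_ne_zero d).symm]
    refine (zero d).congr ?_
    filter_upwards [eventually_gt_atTop t] with k hk
    obtain ⟨q, hq⟩ : ∃ q, k - t = q + 1 := ⟨k - t - 1, by omega⟩
    rw [hq, Nat.multichoose_zero_succ, Nat.cast_zero]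
  | succ D =>
    have h : (fun k => (Nat.multichoose (D + 1) (k - t) : ℤ)) =
        fun k => ((k - t + D).choose D : ℤ) := by
      funext k
      rw [Nat.multichoose_eq, show D + 1 + (k - t) - 1 = k - t + D by omega,
        Nat.choose_symm_add]
    rw [h]
    rcases (Nat.succ_le_succ_iff.1 hr).eq_or_lt with rfl | hlt
    · rw [if_pos rfl]
      exact choose_sub D t
    · rw [if_neg (by omega)]
      exact (choose_sub D t).of_lt hlt

end IsEventuallyHilbertPolynomial

end HilbertPolynomial

/-! ### Counting exponents by truncation -/

section Truncation

variable {n : ℕ}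

/-- The exponent vector all of whose entries are `N`. -/
noncomputable def constExponent (n N : ℕ) : Fin n →₀ ℕ := Finsupp.equivFunOnFinite.symm fun _ => N

@[simp]
theorem constExponent_apply (N : ℕ) (j : Fin n) : constExponent n N j = N := rfl

/-- The positions at which an exponent vector takes the value `N`. -/
def positionsEq (N : ℕ) (u : Fin n →₀ ℕ) : Finset (Fin n) := Finset.univ.filter fun j => u j = N

theorem mem_positionsEq {N : ℕ} {u : Fin n →₀ ℕ} {j : Fin n} :
    j ∈ positionsEq N u ↔ u j = N := by
  simp [positionsEq]

/-- An exponent truncating to `u` agrees with `u` where `u j < N` and may exceed it freely where `u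
j = N`; the excess is a monomial of degree `k - u.degree` in those variables. -/
theorem card_truncation_fiber (N : ℕ) {u : Fin n →₀ ℕ} (hu : u ≤ constExponent n N) {k : ℕ}
    (hk : u.degree ≤ k) :
    (((Finset.univ : Finset (Fin n)).finsuppAntidiag k).filter
      fun d => d ⊓ constExponent n N = u).card =
      Nat.multichoose (positionsEq N u).card (k - u.degree) := by
  classical
  rw [← Finset.card_finsuppAntidiag_nat_eq_multichoose]
  have hu' : ∀ j, u j ≤ N := fun j => hu j
  refine (Finset.card_bij (fun e _ => u + e) ?_ (fun _ _ _ _ h => add_left_cancel h) ?_).symm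
  · intro e he
    rw [Finset.mem_finsuppAntidiag] at he
    rw [Finset.mem_filter, Finset.mem_finsuppAntidiag]
    have hsum : ∑ j, e j = k - u.degree := by
      rw [← he.1]
      refine (Finset.sum_subset (Finset.subset_univ _) fun j _ hj => ?_).symm
      exact Finsupp.notMem_support_iff.1 fun h => hj (he.2 h)
    refine ⟨⟨?_, Finset.subset_univ _⟩, ?_⟩
    · change ∑ j, (u + e) j = k
      rw [← Finsupp.degree_eq_sum, map_add, Finsupp.degree_eq_sum e, hsum]
      omega
    · ext j
      simp only [Finsupp.inf_apply, Finsupp.add_apply, constExponent_apply]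
      by_cases hj : u j = N
      · omega
      · have : e j = 0 := Finsupp.notMem_support_iff.1 fun h => hj (mem_positionsEq.1 (he.2 h))
        have := hu' j
        omega
  · intro d hd
    rw [Finset.mem_filter, Finset.mem_finsuppAntidiag] at hd
    obtain ⟨⟨hsum, -⟩, htr⟩ := hd
    have hj : ∀ j, min (d j) N = u j := fun j => DFunLike.congr_fun htr j
    have hle : u ≤ d := fun j => (hj j) ▸ min_le_left _ _
    obtain ⟨e, rfl⟩ := exists_add_of_le hle
    refine ⟨e, Finset.mem_finsuppAntidiag.2 ⟨?_, ?_⟩, rfl⟩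
    · have hsupp : e.support ⊆ positionsEq N u := fun j hje => by
        have h1 := hj j
        have h2 := Finsupp.mem_support_iff.1 hje
        rw [mem_positionsEq]
        simp only [Finsupp.add_apply] at h1
        omega
      rw [Finset.sum_subset (Finset.subset_univ _) fun j _ hj =>
        Finsupp.notMem_support_iff.1 fun h => hj (hsupp h)]
      change ∑ j, (u + e) j = k at hsum
      change ∑ j, e j = _
      rw [← Finsupp.degree_eq_sum, map_add] at hsum
      rw [← Finsupp.degree_eq_sum]
      omega
    · intro j hje
      have h1 := hj j
      have h2 := Finsupp.mem_support_iff.1 hje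
      rw [mem_positionsEq]
      simp only [Finsupp.add_apply] at h1
      omega

open Classical in
/-- The exponent vectors outside `E` with entries at most `N`. -/
noncomputable def boxCompl (N : ℕ) (E : Set (Fin n →₀ ℕ)) : Finset (Fin n →₀ ℕ) :=
  (Finset.Iic (constExponent n N)).filter (· ∉ E)

theorem mem_boxCompl {N : ℕ} {E : Set (Fin n →₀ ℕ)} {u : Fin n →₀ ℕ} :
    u ∈ boxCompl N E ↔ u ≤ constExponent n N ∧ u ∉ E := by
  simp [boxCompl]

/-- Membership in `E` depends only on the truncation, so the count is a finite sum over truncated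
exponents; only those with the full `D + 1` free positions reach degree `D`. -/
theorem isEventuallyHilbertPolynomial_ncard {E : Set (Fin n →₀ ℕ)} {N : ℕ}
    (hN : ∀ d, d ⊓ constExponent n N ∈ E ↔ d ∈ E) {D : ℕ}
    (hD : ∀ u ∈ boxCompl N E, (positionsEq N u).card ≤ D + 1) :
    IsEventuallyHilbertPolynomial D
      (((boxCompl N E).filter fun u => (positionsEq N u).card = D + 1).card : ℤ)
      fun k => ({d | d ∉ E ∧ d.degree = k}.ncard : ℤ) := by
  classical
  rw [Finset.card_filter, Nat.cast_sum]
  push_cast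
  refine (IsEventuallyHilbertPolynomial.sum (boxCompl N E) fun u hu =>
    IsEventuallyHilbertPolynomial.multichoose_sub (hD u hu) u.degree).congr ?_
  have hev : ∀ᶠ k : ℕ in atTop, ∀ u ∈ boxCompl N E, u.degree ≤ k :=
    (Finset.eventually_all (boxCompl N E)).2 fun u _ => eventually_ge_atTop _
  filter_upwards [hev] with k hk
  have hset : {d | d ∉ E ∧ d.degree = k} =
      ((((Finset.univ : Finset (Fin n)).finsuppAntidiag k).filter (· ∉ E) :
        Finset (Fin n →₀ ℕ)) : Set (Fin n →₀ ℕ)) := by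
    ext d
    simp [Finset.mem_finsuppAntidiag, Finsupp.degree_eq_sum, and_comm]
  rw [hset, Set.ncard_coe_finset, Finset.card_eq_sum_card_fiberwise
    (f := fun d => d ⊓ constExponent n N) (t := boxCompl N E), Nat.cast_sum]
  · refine Finset.sum_congr rfl fun u hu => ?_
    rw [← card_truncation_fiber N (mem_boxCompl.1 hu).1 (hk u hu), Finset.filter_filter]
    congr 2
    ext d
    simp only [Finset.mem_filter, and_congr_right_iff, and_iff_right_iff_imp]
    rintro - rfl
    rw [← hN]
    exact (mem_boxCompl.1 hu).2
  · intro d hd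
    rw [Finset.mem_coe, Finset.mem_filter] at hd
    rw [Finset.mem_coe, mem_boxCompl, hN]
    exact ⟨inf_le_right, hd.2⟩

theorem compl_eq_boxCompl {E : Set (Fin n →₀ ℕ)} {N : ℕ}
    (hN : ∀ d, d ⊓ constExponent n N ∈ E ↔ d ∈ E)
    (hD : ∀ u ∈ boxCompl N E, (positionsEq N u).card = 0) : Eᶜ = boxCompl N E := by
  ext d
  rw [Finset.mem_coe, mem_boxCompl]
  refine ⟨fun hd => ⟨fun j => ?_, hd⟩, fun hd => hd.2⟩
  have h := hD (d ⊓ constExponent n N) (mem_boxCompl.2 ⟨inf_le_right, (hN d).not.2 hd⟩)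
  rw [Finset.card_eq_zero] at h
  have hj : j ∉ positionsEq N (d ⊓ constExponent n N) := by simp [h]
  rw [mem_positionsEq] at hj
  simp only [Finsupp.inf_apply, constExponent_apply] at hj ⊢
  omega

/-- Dickson's lemma: there are finitely many minimal exponents, and `N` is taken to bound all their
entries. -/
theorem exists_truncation_bound {E : Set (Fin n →₀ ℕ)} (hE : IsUpperSet E) :
    ∃ N, ∀ d, d ⊓ constExponent n N ∈ E ↔ d ∈ E := by
  have hfin : {a | Minimal (· ∈ E) a}.Finite :=
    WellQuasiOrderedLE.finite_of_isAntichain (setOfPred_minimal_antichain _)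
  refine ⟨hfin.toFinset.sup fun a => a.degree, fun d => ⟨fun h => hE inf_le_left h, fun h => ?_⟩⟩
  obtain ⟨a, had, ha⟩ := exists_minimal_le_of_wellFoundedLT (· ∈ E) d h
  refine hE (le_inf had fun j => ?_) ha.prop
  rw [constExponent_apply]
  exact (Finsupp.le_degree j a).trans
    (Finset.le_sup (f := fun a : Fin n →₀ ℕ => a.degree) (hfin.mem_toFinset.2 ha))

end Truncation

/-! ### The associativity formula -/

section Multiplicity

variable {K : Type*} [Field K] {n : ℕ}

/-- The exponent vectors, supported in `v`, of the monomials outside the localization of `I` at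
the prime ideal generated by the variables in `v`. -/
def localCompl (I : Ideal (MvPolynomial (Fin n) K)) (v : Finset (Fin n)) : Set (Fin n →₀ ℕ) :=
  {d | d.support ⊆ v ∧ d ∉ localExponents I v}

/-- The sum of the lengths of the localizations of `R/I` at the monomial primes of height `h`. -/
noncomputable def localLengthSum (I : Ideal (MvPolynomial (Fin n) K)) (h : ℕ) : ℕ :=
  ∑ v ∈ Finset.univ.powersetCard h, (localCompl I v).ncard

/-- The prime generated by the variables with `u j ≠ N` contains `I`: a monomial of `I` avoiding
those variables would, once truncated, divide `u`. Its height is then at least `h`. -/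
theorem card_positionsEq_le {I : Ideal (MvPolynomial (Fin n) K)} (hI : IsMonomialIdeal I) {h : ℕ}
    (hh : I.height = h) {N : ℕ}
    (hN : ∀ d, d ⊓ constExponent n N ∈ monomialExponents I ↔ d ∈ monomialExponents I)
    {u : Fin n →₀ ℕ} (hu : u ∈ boxCompl N (monomialExponents I)) :
    (positionsEq N u).card ≤ n - h := by
  classical
  rw [mem_boxCompl] at hu
  have hle : I ≤ varIdeal K (positionsEq N u)ᶜ := by
    by_contra hcon
    obtain ⟨d, hd, h0⟩ := (not_le_varIdeal_iff hI).1 hcon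
    refine hu.2 (isUpperSet_monomialExponents I (fun j => ?_) ((hN d).2 hd))
    simp only [Finsupp.inf_apply, constExponent_apply]
    by_cases hj : u j = N
    · rw [hj]
      exact min_le_right _ _
    · rw [h0 j (by simpa [mem_positionsEq] using hj)]
      simp
  have h1 := Ideal.height_mono hle
  rw [hh, height_varIdeal, Finset.card_compl, Fintype.card_fin] at h1
  have h2 : h ≤ n - (positionsEq N u).card := by exact_mod_cast h1
  have h3 := (positionsEq N u).card_le_univ
  rw [Fintype.card_fin] at h3
  omega

/-- Restriction to `v` is the bijection. Its inverse puts `N` at every position outside `v`. -/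
theorem ncard_localCompl {I : Ideal (MvPolynomial (Fin n) K)} (hI : IsMonomialIdeal I) {h : ℕ}
    (hh : I.height = h) {N : ℕ}
    (hN : ∀ d, d ⊓ constExponent n N ∈ monomialExponents I ↔ d ∈ monomialExponents I)
    {v : Finset (Fin n)} (hv : v.card = h) :
    ((boxCompl N (monomialExponents I)).filter fun u => (positionsEq N u)ᶜ = v).card =
      (localCompl I v).ncard := by
  classical
  rw [← Set.ncard_coe_finset]
  refine Set.ncard_congr (fun u _ => u.filter (· ∈ v)) ?_ ?_ ?_
  · intro u hu
    rw [Finset.mem_coe, Finset.mem_filter, mem_boxCompl] at hu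
    obtain ⟨⟨-, huE⟩, rfl⟩ := hu
    refine ⟨fun j hj => ?_, ?_⟩
    · rw [Finsupp.support_filter] at hj
      exact (Finset.mem_filter.1 hj).2
    rintro ⟨c, hc, hmem⟩
    refine huE (isUpperSet_monomialExponents I (fun j => ?_) ((hN _).2 hmem))
    simp only [Finsupp.inf_apply, Finsupp.add_apply, constExponent_apply]
    by_cases hj : u j = N
    · rw [hj]
      exact min_le_right _ _
    · have hjv : j ∈ (positionsEq N u)ᶜ := by simpa [mem_positionsEq] using hj
      rw [hc j hjv, Finsupp.filter_apply_pos _ _ hjv, add_zero]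
      exact min_le_left _ _
  · intro u w hu hw huw
    rw [Finset.mem_coe, Finset.mem_filter] at hu hw
    ext j
    by_cases hj : j ∈ v
    · have := DFunLike.congr_fun huw j
      simpa [Finsupp.filter_apply, hj] using this
    · have h1 : j ∈ positionsEq N u := by
        by_contra h
        exact hj (hu.2 ▸ Finset.mem_compl.2 h)
      have h2 : j ∈ positionsEq N w := by
        by_contra h
        exact hj (hw.2 ▸ Finset.mem_compl.2 h)
      rw [mem_positionsEq.1 h1, mem_positionsEq.1 h2]
  · rintro d ⟨hsupp, hd⟩
    set c : Fin n →₀ ℕ := (constExponent n N).filter (· ∉ v) with hc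
    have hdc : d + c ∉ monomialExponents I := fun hmem =>
      hd ⟨c, fun j hj => by simp [hc, hj], hmem⟩
    set u := (d + c) ⊓ constExponent n N with hu
    have hubox : u ∈ boxCompl N (monomialExponents I) :=
      mem_boxCompl.2 ⟨inf_le_right, (hN _).not.2 hdc⟩
    have hsub : vᶜ ⊆ positionsEq N u := by
      intro j hj
      rw [Finset.mem_compl] at hj
      rw [mem_positionsEq]
      simp [hu, hc, hj]
    -- The `n - h` positions outside `v` already exhaust the bound, so no entry inside `v` reaches
    -- `N` and truncation loses nothing there.
    have heq : vᶜ = positionsEq N u := by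
      refine Finset.eq_of_subset_of_card_le hsub ?_
      rw [Finset.card_compl, Fintype.card_fin, hv]
      exact card_positionsEq_le hI hh hN hubox
    refine ⟨u, ?_, ?_⟩
    · rw [Finset.mem_coe, Finset.mem_filter]
      exact ⟨hubox, by rw [← heq, compl_compl]⟩
    · ext j
      by_cases hj : j ∈ v
      · have h1 : j ∉ positionsEq N u := by
          rw [← heq]
          simpa using hj
        rw [mem_positionsEq] at h1
        have h2 : u j = min (d j) N := by simp [hu, hc, hj]
        rw [Finsupp.filter_apply_pos _ _ hj]
        omega
      · rw [Finsupp.filter_apply_neg _ _ hj]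
        exact (Finsupp.notMem_support_iff.1 fun h => hj (hsupp h)).symm

theorem card_filter_boxCompl {I : Ideal (MvPolynomial (Fin n) K)} (hI : IsMonomialIdeal I) {h : ℕ}
    (hh : I.height = h) (hn : h ≤ n) {N : ℕ}
    (hN : ∀ d, d ⊓ constExponent n N ∈ monomialExponents I ↔ d ∈ monomialExponents I) :
    ((boxCompl N (monomialExponents I)).filter fun u => (positionsEq N u).card = n - h).card =
      localLengthSum I h := by
  classical
  rw [Finset.card_eq_sum_card_fiberwise (f := fun u => (positionsEq N u)ᶜ)
    (t := Finset.univ.powersetCard h)]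
  · refine Finset.sum_congr rfl fun v hv => ?_
    have hv' := (Finset.mem_powersetCard.1 hv).2
    rw [← ncard_localCompl hI hh hN hv', Finset.filter_filter]
    congr 2
    ext u
    simp only [and_iff_right_iff_imp]
    rintro rfl
    rw [Finset.card_compl, Fintype.card_fin] at hv'
    have h3 := (positionsEq N u).card_le_univ
    rw [Fintype.card_fin] at h3
    omega
  · intro u hu
    rw [Finset.mem_coe, Finset.mem_filter] at hu
    rw [Finset.mem_coe, Finset.mem_powersetCard, Finset.card_compl, Fintype.card_fin, hu.2]
    exact ⟨Finset.subset_univ _, by omega⟩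

/-- The associativity formula for the multiplicity of a monomial ideal. -/
theorem IsMonomialIdeal.hasMultiplicity {I : Ideal (MvPolynomial (Fin n) K)}
    (hI : IsMonomialIdeal I) {h : ℕ} (hh : I.height = h) :
    HasMultiplicity I (localLengthSum I h) := by
  have hn : h ≤ n := by
    obtain ⟨v, hv, -⟩ := hI.exists_le_varIdeal hh
    rw [← hv]
    simpa using v.card_le_univ
  obtain ⟨N, hN⟩ := exists_truncation_bound (isUpperSet_monomialExponents I)
  have hcard := card_filter_boxCompl hI hh hn hN
  have hle := fun u hu => card_positionsEq_le hI hh hN (u := u) hu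
  have hdim := hI.ringKrullDim_quotient hh
  -- In dimension zero the multiplicity is a length: no truncated exponent has an entry `N`, so the
  -- box holds every monomial outside `I`. Otherwise `D` is the dimension minus one.
  rcases hnh : n - h with _ | D
  · rw [hnh] at hcard hdim hle
    have h0 := fun u hu => Nat.le_zero.1 (hle u hu)
    have hcompl := compl_eq_boxCompl hN h0
    obtain ⟨h1, h2⟩ := hI.finite_quotient (hcompl ▸ Finset.finite_toSet _)
    refine Or.inl ⟨hdim, h1, ?_⟩
    rw [h2, hcompl, Set.ncard_coe_finset, ← hcard, Finset.filter_true_of_mem h0]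
  · rw [hnh] at hcard hdim hle
    obtain ⟨c, hc, hev⟩ := isEventuallyHilbertPolynomial_ncard hN hle
    refine Or.inr ⟨D, hdim, c, by rw [hc, hcard], ?_⟩
    filter_upwards [hev] with k hk
    rw [hI.hilbertFunction_eq, hk]

end Multiplicity

/-! ### Counting lattice points by division with remainder -/

section Counting

variable {n : ℕ}

theorem sum_range_multichoose (h s : ℕ) :
    ∑ i ∈ Finset.range (s + 1), Nat.multichoose h i = Nat.multichoose (h + 1) s := by
  induction s with
  | zero => simp
  | succ s ih => rw [Finset.sum_range_succ, ih, Nat.multichoose_succ_succ, add_comm]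

theorem card_biUnion_finsuppAntidiag (v : Finset (Fin n)) (s : ℕ) :
    ((Finset.range (s + 1)).biUnion fun i => v.finsuppAntidiag i).card =
      Nat.multichoose (v.card + 1) s := by
  rw [Finset.card_biUnion, ← sum_range_multichoose]
  · exact Finset.sum_congr rfl fun i _ => Finset.card_finsuppAntidiag_nat_eq_multichoose _
  · intro i _ j _ hij
    rw [Function.onFun, Finset.disjoint_left]
    intro q hq hq'
    rw [Finset.mem_finsuppAntidiag] at hq hq'
    exact hij (hq.1.symm.trans hq'.1)

/-- Write d_j = b_j q_j + r_j: the remainders fill a box of size ∏ b_j, and the quotients range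
independently over the monomials of degree at most `s`. -/
theorem ncard_sum_div_lt (v : Finset (Fin n)) {b : Fin n → ℕ} (hb : ∀ j ∈ v, 0 < b j) (s : ℕ) :
    {d : Fin n →₀ ℕ | d.support ⊆ v ∧ ∑ j ∈ v, d j / b j < s + 1}.ncard =
      (∏ j ∈ v, b j) * Nat.multichoose (v.card + 1) s := by
  classical
  let A := (Finset.range (s + 1)).biUnion fun i => v.finsuppAntidiag i
  let B := v.finsupp fun j => Finset.range (b j)
  have hB : B.card = ∏ j ∈ v, b j := by simp [B, Finset.card_finsupp]
  rw [← hB, ← card_biUnion_finsuppAntidiag, mul_comm, ← Finset.card_product, ← Set.ncard_coe_finset]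
  have hmem : ∀ x : (Fin n →₀ ℕ) × (Fin n →₀ ℕ), x ∈ A ×ˢ B ↔
      (x.1.support ⊆ v ∧ ∑ j ∈ v, x.1 j < s + 1) ∧ x.2.support ⊆ v ∧ ∀ j ∈ v, x.2 j < b j := by
    intro x
    simp only [A, B, Finset.mem_product, Finset.mem_biUnion, Finset.mem_finsuppAntidiag,
      Finset.mem_finsupp_iff, Finset.mem_range]
    refine and_congr_left fun _ => ⟨?_, fun h => ⟨_, h.2, rfl, h.1⟩⟩
    rintro ⟨i, hi, rfl, h⟩
    exact ⟨h, hi⟩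
  refine (Set.ncard_congr (fun x _ => Finsupp.equivFunOnFinite.symm
    fun j => b j * x.1 j + x.2 j) ?_ ?_ ?_).symm
  · intro x hx
    obtain ⟨⟨h1, h2⟩, h3, h4⟩ := (hmem x).1 hx
    refine ⟨fun j hj => ?_, ?_⟩
    · by_contra hjv
      have e1 : x.1 j = 0 := Finsupp.notMem_support_iff.1 fun h => hjv (h1 h)
      have e2 : x.2 j = 0 := Finsupp.notMem_support_iff.1 fun h => hjv (h3 h)
      simp [e1, e2] at hj
    · refine lt_of_eq_of_lt (Finset.sum_congr rfl fun j hj => ?_) h2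
      rw [Finsupp.coe_equivFunOnFinite_symm, Nat.mul_add_div (hb j hj),
        Nat.div_eq_of_lt (h4 j hj), add_zero]
  · intro x y hx hy hxy
    obtain ⟨⟨h1, -⟩, h3, h4⟩ := (hmem x).1 hx
    obtain ⟨⟨h1', -⟩, h3', h4'⟩ := (hmem y).1 hy
    have key : ∀ j, x.1 j = y.1 j ∧ x.2 j = y.2 j := by
      intro j
      by_cases hj : j ∈ v
      · have h : b j * x.1 j + x.2 j = b j * y.1 j + y.2 j := DFunLike.congr_fun hxy j
        have hdiv := congrArg (· / b j) h
        have hmod := congrArg (· % b j) h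
        simp only [Nat.mul_add_div (hb j hj), Nat.div_eq_of_lt (h4 j hj),
          Nat.div_eq_of_lt (h4' j hj), add_zero] at hdiv
        simp only [Nat.mul_add_mod, Nat.mod_eq_of_lt (h4 j hj),
          Nat.mod_eq_of_lt (h4' j hj)] at hmod
        exact ⟨hdiv, hmod⟩
      · rw [Finsupp.notMem_support_iff.1 fun h => hj (h1 h),
          Finsupp.notMem_support_iff.1 fun h => hj (h1' h),
          Finsupp.notMem_support_iff.1 fun h => hj (h3 h),
          Finsupp.notMem_support_iff.1 fun h => hj (h3' h)]
        exact ⟨rfl, rfl⟩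
    exact Prod.ext (Finsupp.ext fun j => (key j).1) (Finsupp.ext fun j => (key j).2)
  · rintro d ⟨hsupp, hlt⟩
    have h0 : ∀ j, j ∉ v → d j = 0 := fun j hj =>
      Finsupp.notMem_support_iff.1 fun h => hj (hsupp h)
    refine ⟨(Finsupp.equivFunOnFinite.symm fun j => d j / b j,
      Finsupp.equivFunOnFinite.symm fun j => d j % b j), ?_, ?_⟩
    · rw [Finset.mem_coe, hmem]
      refine ⟨⟨fun j hj => ?_, hlt⟩, fun j hj => ?_, fun j hj => Nat.mod_lt _ (hb j hj)⟩ <;>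
      · by_contra hjv
        simp [h0 j hjv] at hj
    · ext j
      exact Nat.div_add_mod (d j) (b j)

end Counting

/-! ### Multiplicity of powers of special powers -/

section SpecialPowers

variable {K : Type*} [Field K] {n : ℕ}

theorem IsMonomialIdeal.ncard_localCompl_pow {I : Ideal (MvPolynomial (Fin n) K)}
    (hI : IsMonomialIdeal I) {v : Finset (Fin n)} {b : Fin n → ℕ} (hb : ∀ j ∈ v, 0 < b j)
    (hloc : ∀ d, d ∈ localExponents I v ↔ ∃ j ∈ v, b j ≤ d j) (s : ℕ) :
    (localCompl (I ^ (s + 1)) v).ncard =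
      (∏ j ∈ v, b j) * Nat.multichoose (v.card + 1) s := by
  rw [← ncard_sum_div_lt v hb]
  congr 1
  ext d
  simp only [localCompl, Set.mem_ofPred_eq, hI.mem_localExponents_pow hb hloc, not_le]

theorem IsMonomialIdeal.localCompl_eq_empty {I : Ideal (MvPolynomial (Fin n) K)}
    (hI : IsMonomialIdeal I) {v : Finset (Fin n)} (h : ¬ I ≤ varIdeal K v) :
    localCompl I v = ∅ := by
  obtain ⟨c, hc, hc0⟩ := (not_le_varIdeal_iff hI).1 h
  refine Set.eq_empty_of_forall_notMem fun d hd => hd.2 ⟨c, hc0, ?_⟩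
  exact isUpperSet_monomialExponents I le_add_self hc

/-- The two sums are compared term by term: a prime containing `I` scales its term by the common
factor, and any other contributes zero on both sides. -/
theorem HasIrreducibleTopComponents.localLengthSum_specialPower_pow
    {I : Ideal (MvPolynomial (Fin n) K)} {h : ℕ} (hI : HasIrreducibleTopComponents I h) {m : ℕ}
    (hm : 1 ≤ m) (s : ℕ) :
    localLengthSum (_root_.specialPower I m ^ (s + 1)) h =
      m ^ h * (h + s).choose s * localLengthSum I h := by
  have hImon := hI.isMonomialIdeal
  have hJmon := isMonomialIdeal_specialPower I m
  rw [localLengthSum, localLengthSum, Finset.mul_sum]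
  refine Finset.sum_congr rfl fun v hv => ?_
  have hv' := (Finset.mem_powersetCard.1 hv).2
  by_cases hle : I ≤ varIdeal K v
  · obtain ⟨a, ha, hloc⟩ := hI.exists_localExponents_iff hv' hle
    -- The first power of `I` itself gives the local length ∏ a_j.
    have h1 := hImon.ncard_localCompl_pow ha hloc 0
    rw [zero_add, pow_one, Nat.multichoose_zero_right, mul_one] at h1
    rw [hJmon.ncard_localCompl_pow (fun j hj => Nat.mul_pos hm (ha j hj))
      (mem_localExponents_specialPower hloc m) s, h1, Finset.prod_mul_distrib,
      Finset.prod_const, hv', Nat.multichoose_eq, show h + 1 + s - 1 = h + s by omega]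
    ring
  · rw [hImon.localCompl_eq_empty hle, (hJmon.pow (s + 1)).localCompl_eq_empty, Set.ncard_empty,
      mul_zero]
    rw [Ideal.IsPrime.pow_le_iff (Nat.succ_ne_zero s),
      hImon.specialPower_le_iff inferInstance hm]
    exact hle

end SpecialPowers

theorem theorem2p10 {K : Type*} [Field K] {n : ℕ}
    (I : Ideal (MvPolynomial (Fin n) K)) (h : ℕ) (hI : HasIrreducibleTopComponents I h) :
    (∀ m : ℕ, 1 ≤ m → HasIrreducibleTopComponents (specialPower I m) h) ∧
    ∃ e : ℤ, HasMultiplicity I e ∧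
      ∀ m s : ℕ, 1 ≤ m → 1 ≤ s →
        HasMultiplicity (specialPower I m ^ s)
          ((m : ℤ) ^ h * ((h + s - 1).choose (s - 1) : ℤ) * e) := by
  refine ⟨fun m hm => hI.specialPower hm, localLengthSum I h,
    hI.isMonomialIdeal.hasMultiplicity hI.height_eq, fun m s hm hs => ?_⟩
  obtain ⟨s, rfl⟩ := Nat.exists_eq_add_of_le' hs
  have hheight : (specialPower I m ^ (s + 1)).height = h := by
    rw [← hI.height_eq]
    exact Ideal.height_eq_of_isPrime_le_iff fun P hP => by
      rw [Ideal.IsPrime.pow_le_iff (Nat.succ_ne_zero s),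
        hI.isMonomialIdeal.specialPower_le_iff hP hm]
  have := ((isMonomialIdeal_specialPower I m).pow (s + 1)).hasMultiplicity hheight
  rw [hI.localLengthSum_specialPower_pow hm s] at this
  rw [show h + (s + 1) - 1 = h + s by omega, Nat.add_sub_cancel]
  exact_mod_cast this
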